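/- Let $X$ be a Hausdorff topological vector space over $\mathbb{C}$ whose space $X^*$ of continuous linear functionals $X\to\mathbb{C}$ is not $\{0\}$, let $T$ be a continuous linear operator on $X$ and let $\Lambda\subseteq[0,\infty)\times\mathbb{C}$ be an arbitrary set. Suppose that the family $\{aT+bI:(a,b)\in\Lambda\}$ has a common hypercyclic vector, that is, there is $x\in X$ such that for every $(a,b)\in\Lambda$ the orbit $\{(aT+bI)^n x : n=0,1,2,\dots\}$ is dense in $X$. Then $\Lambda$ has three-dimensional Lebesgue measure zero (as a subset of $\mathbb{R}\times\mathbb{C}\cong\mathbb{R}^3$). -/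

import Mathlib

/-- The set of universal elements of a family `F` of maps from `X` to `Y`: those `x` whose orbit
`{F a x : a}` is dense in `Y`. -/
def universalElements {A X Y : Type*} [TopologicalSpace Y] (F : A → X → Y) : Set X :=
  {x | Dense (Set.range fun a => F a x)}

/-- The set of hypercyclic vectors of a continuous linear operator `T`: the universal elements of
the family of its powers `T ^ n`, `n = 0, 1, 2, …`. -/
def hypercyclicVectors {𝕜 X : Type*} [RCLike 𝕜] [AddCommGroup X] [Module 𝕜 X]
    [TopologicalSpace X] (T : X →L[𝕜] X) : Set X :=
  universalElements fun (n : ℕ) (x : X) => (T ^ n) x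

/-- The set of common hypercyclic vectors of a family of continuous linear operators. -/
def commonHypercyclicVectors {𝕜 X A : Type*} [RCLike 𝕜] [AddCommGroup X] [Module 𝕜 X]
    [TopologicalSpace X] (T : A → (X →L[𝕜] X)) : Set X :=
  ⋂ a, hypercyclicVectors (T a)

/-! For `a > 0` put `b = a w`, so that `S = aT + bI = a(T + wI)`. For a functional `f ≠ 0`, `f (S ^
m x) = a ^ m * q_m(w)`, where the polynomials `q_m` have degree at most `m`, do not depend on `(a,
w)`, and satisfy `q_m' = m q_{m-1}`. Density of the orbit forces, for infinitely many `m`, that `a ^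
m |q_m(w)|` lies between two positive constants and that `(q_m'^2 - q_m q_m'') / q_m^2 = ∑ (w -
z)⁻²`, over the zeros `z` of `q_m`, has modulus at least a constant times `m ^ 2`. Such pairs are
rare: in a disc the second condition leaves area `O(m ^ (-1/2))`, and for fixed `w` the first leaves
length `O(1/m)` for `a`. The product `m ^ (-3/2)` is summable, and Borel–Cantelli applies
(`volume_frequently_mem_steepSet`, `exists_frequently_mem_steepSet`). -/

/-! ### Second logarithmic derivatives of polynomials. -/

section LogDerivative

open Polynomial

/-- The second logarithmic derivative of a product of linear factors. -/
theorem eval_derivative_sq_sub_multiset_prod (Z : Multiset ℂ) (w : ℂ)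
    (hw : (Z.map fun z => X - C z).prod.eval w ≠ 0) :
    (derivative (Z.map fun z => X - C z).prod).eval w ^ 2
      - (Z.map fun z => X - C z).prod.eval w
        * (derivative (derivative (Z.map fun z => X - C z).prod)).eval w
      = (Z.map fun z => X - C z).prod.eval w ^ 2 * (Z.map fun z => ((w - z) ^ 2)⁻¹).sum := by
  induction Z using Multiset.induction_on with
  | empty => simp
  | cons z Z ih =>
    simp only [Multiset.map_cons, Multiset.prod_cons, Multiset.sum_cons, eval_mul, eval_sub,
      eval_X, eval_C, mul_ne_zero_iff] at hw ⊢
    obtain ⟨hz, hZ⟩ := hw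
    have h := ih hZ
    simp only [derivative_mul, derivative_sub, derivative_X, derivative_C, sub_zero, one_mul,
      derivative_add, eval_add, eval_mul, eval_sub, eval_X, eval_C]
    set P := (Z.map fun z => X - C z).prod
    have : (w - z) ^ 2 * ((w - z) ^ 2)⁻¹ = 1 := mul_inv_cancel₀ (pow_ne_zero _ hz)
    linear_combination (w - z) ^ 2 * h - eval w P ^ 2 * this

theorem eval_derivative_sq_sub (P : ℂ[X]) (w : ℂ) (hw : P.eval w ≠ 0) :
    (derivative P).eval w ^ 2 - P.eval w * (derivative (derivative P)).eval w
      = P.eval w ^ 2 * (P.roots.map fun z => ((w - z) ^ 2)⁻¹).sum := by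
  have hP := (IsAlgClosed.splits P).eq_prod_roots
  set c := P.leadingCoeff
  set R := (P.roots.map fun z => X - C z).prod with hR
  have hw' : R.eval w ≠ 0 := by
    intro h
    rw [hP] at hw
    simp [h] at hw
  have h := eval_derivative_sq_sub_multiset_prod P.roots w hw'
  rw [← hR] at h
  have h1 : P.eval w = c * R.eval w := by rw [hP]; simp
  have h2 : (derivative P).eval w = c * (derivative R).eval w := by
    rw [hP]; simp
  have h3 : (derivative (derivative P)).eval w = c * (derivative (derivative R)).eval w := by
    rw [hP]; simp
  rw [h1, h2, h3]
  linear_combination c ^ 2 * h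

end LogDerivative

/-! ### Area where a sum of inverse squares is large. -/

section Area

open MeasureTheory Metric ENNReal

/-- The kernel `‖v‖ ^ (-3/2)` on `ℂ`, with value `0` at the origin. -/
noncomputable def invKernel (v : ℂ) : ℝ≥0∞ := ‖(v ^ 2)⁻¹‖ₑ ^ (3 / 4 : ℝ)

theorem measurable_invKernel : Measurable invKernel := by
  unfold invKernel
  fun_prop

theorem lintegral_ball_one_invKernel_lt_top : ∫⁻ v in ball (0 : ℂ) 1, invKernel v < ∞ := by
  have hm : Measurable fun v : ℂ => ‖(v ^ 2)⁻¹‖ ^ (3 / 4 : ℝ) := by fun_prop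
  have h : IntegrableOn (fun v : ℂ => ‖(v ^ 2)⁻¹‖ ^ (3 / 4 : ℝ)) (ball 0 1) := by
    refine integrableOn_ball_of_norm_le_rpow (C := 1) (α := 3 / 2) (by simp) ?_ ?_
      hm.aestronglyMeasurable
    · rw [Complex.finrank_real_complex]; norm_num
    · refine Filter.Eventually.of_forall fun v => ?_
      rw [Real.norm_of_nonneg (by positivity), one_mul, norm_inv, norm_pow,
        Real.inv_rpow (by positivity), ← Real.rpow_natCast, ← Real.rpow_mul (norm_nonneg _),
        Real.rpow_neg (norm_nonneg _)]
      norm_num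
  have h2 := h.2
  rw [HasFiniteIntegral] at h2
  refine lt_of_eq_of_lt (lintegral_congr fun v => ?_) h2
  rw [invKernel, ← ofReal_norm, ← ofReal_norm, ENNReal.ofReal_rpow_of_nonneg (by positivity)
    (by norm_num), Real.norm_of_nonneg (r := ‖(v ^ 2)⁻¹‖ ^ (3 / 4 : ℝ)) (by positivity)]

theorem invKernel_le_one {v : ℂ} (hv : 1 ≤ ‖v‖) : invKernel v ≤ 1 := by
  refine ENNReal.rpow_le_one ?_ (by norm_num)
  rw [← ofReal_norm, ENNReal.ofReal_le_one, norm_inv, norm_pow]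
  exact inv_le_one_of_one_le₀ (one_le_pow₀ hv)

theorem lintegral_ball_invKernel_sub_le (K : ℝ) (z : ℂ) :
    ∫⁻ w in ball (0 : ℂ) K, invKernel (w - z)
      ≤ (∫⁻ v in ball (0 : ℂ) 1, invKernel v) + volume (ball (0 : ℂ) K) := by
  have h1 : ∀ w, invKernel (w - z) ≤ (ball (0 : ℂ) 1).indicator invKernel (w - z) + 1 := by
    intro w
    by_cases hw : w - z ∈ ball (0 : ℂ) 1
    · rw [Set.indicator_of_mem hw]; exact le_self_add
    · rw [Set.indicator_of_notMem hw, zero_add]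
      exact invKernel_le_one (by simpa using hw)
  calc ∫⁻ w in ball (0 : ℂ) K, invKernel (w - z)
      ≤ ∫⁻ w in ball (0 : ℂ) K, ((ball (0 : ℂ) 1).indicator invKernel (w - z) + 1) :=
        lintegral_mono h1
    _ = (∫⁻ w in ball (0 : ℂ) K, (ball (0 : ℂ) 1).indicator invKernel (w - z))
          + volume (ball (0 : ℂ) K) := by
        rw [lintegral_add_right _ measurable_const]; simp
    _ ≤ (∫⁻ w, (ball (0 : ℂ) 1).indicator invKernel (w - z)) + volume (ball (0 : ℂ) K) := by
        gcongr; exact Measure.restrict_le_self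
    _ = _ := by
        rw [lintegral_sub_right_eq_self (fun v => (ball (0 : ℂ) 1).indicator invKernel v),
          lintegral_indicator measurableSet_ball]

theorem lintegral_multiset_sum_invKernel_le (K : ℝ) (Z : Multiset ℂ) :
    ∫⁻ w in ball (0 : ℂ) K, (Z.map fun z => invKernel (w - z)).sum
      ≤ Z.card * ((∫⁻ v in ball (0 : ℂ) 1, invKernel v) + volume (ball (0 : ℂ) K)) := by
  induction Z using Multiset.induction_on with
  | empty => simp
  | cons z Z ih =>
    simp only [Multiset.map_cons, Multiset.sum_cons, Multiset.card_cons]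
    rw [lintegral_add_left (by exact measurable_invKernel.comp (measurable_id.sub_const z))]
    push_cast
    rw [add_mul, one_mul, add_comm]
    exact add_le_add ih (lintegral_ball_invKernel_sub_le K z)

/-- The power `p = 3/4` is subadditive as `p ≤ 1`. Local integrability of `‖v‖ ^ (-2p)` on the plane
needs `p < 1`; the final bound `m ^ (-2p)` is summable only for `p > 1/2`. -/
theorem enorm_multiset_sum_rpow_le (Z : Multiset ℂ) (w : ℂ) :
    ‖(Z.map fun z => ((w - z) ^ 2)⁻¹).sum‖ₑ ^ (3 / 4 : ℝ)
      ≤ (Z.map fun z => invKernel (w - z)).sum := by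
  induction Z using Multiset.induction_on with
  | empty => simp
  | cons z Z ih =>
    simp only [Multiset.map_cons, Multiset.sum_cons]
    calc _ ≤ (‖((w - z) ^ 2)⁻¹‖ₑ + ‖(Z.map fun z => ((w - z) ^ 2)⁻¹).sum‖ₑ) ^ (3 / 4 : ℝ) := by
          gcongr; exact enorm_add_le _ _
      _ ≤ _ := ENNReal.rpow_add_le_add_rpow _ _ (by norm_num) (by norm_num)
      _ ≤ _ := by gcongr; exact le_rfl

/-- The set in a disc on which the sum of the inverse squares of the distances to finitely many
points is large has small area. -/
theorem volume_le_norm_sum_inv_sq (K : ℝ) : ∃ C : ℝ, 0 ≤ C ∧ ∀ (Z : Multiset ℂ) (t : ℝ), 0 < t →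
    volume {w : ℂ | ‖w‖ < K ∧ t ≤ ‖(Z.map fun z => ((w - z) ^ 2)⁻¹).sum‖}
      ≤ ENNReal.ofReal (C * Z.card / t ^ (3 / 4 : ℝ)) := by
  set A := (∫⁻ v in ball (0 : ℂ) 1, invKernel v) + volume (ball (0 : ℂ) K) with hA
  have hAt : A ≠ ∞ :=
    ENNReal.add_ne_top.2 ⟨lintegral_ball_one_invKernel_lt_top.ne, measure_ball_lt_top.ne⟩
  refine ⟨A.toReal, ENNReal.toReal_nonneg, fun Z t ht => ?_⟩
  have ht' : 0 < t ^ (3 / 4 : ℝ) := Real.rpow_pos_of_pos ht _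
  have hm : Measurable fun w : ℂ => (Z.map fun z => invKernel (w - z)).sum := by
    induction Z using Multiset.induction_on with
    | empty => simp
    | cons z Z ih =>
      simp only [Multiset.map_cons, Multiset.sum_cons]
      exact (measurable_invKernel.comp (measurable_id.sub_const z)).add ih
  have h1 := mul_meas_ge_le_lintegral (μ := volume.restrict (ball (0 : ℂ) K)) hm
    (ENNReal.ofReal (t ^ (3 / 4 : ℝ)))
  have h2 : volume {w : ℂ | ‖w‖ < K ∧ t ≤ ‖(Z.map fun z => ((w - z) ^ 2)⁻¹).sum‖}
      ≤ (volume.restrict (ball (0 : ℂ) K)) {w | ENNReal.ofReal (t ^ (3 / 4 : ℝ))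
        ≤ (Z.map fun z => invKernel (w - z)).sum} := by
    rw [Measure.restrict_apply (measurableSet_le measurable_const hm)]
    refine measure_mono fun w hw => ⟨?_, by simpa using hw.1⟩
    refine le_trans ?_ (enorm_multiset_sum_rpow_le Z w)
    rw [← ENNReal.ofReal_rpow_of_nonneg ht.le (by norm_num), ← ofReal_norm]
    gcongr
    exact hw.2
  rw [ENNReal.ofReal_div_of_pos ht', ENNReal.le_div_iff_mul_le (by simp [ht']) (by simp),
    mul_comm A.toReal, ENNReal.ofReal_mul (by positivity), ENNReal.ofReal_toReal hAt,
    ENNReal.ofReal_natCast, mul_comm]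
  exact (mul_le_mul_right h2 _).trans (h1.trans (lintegral_multiset_sum_invKernel_le K Z))

end Area

/-! ### Measure of the exceptional sets and Borel–Cantelli. -/

section Slices

open MeasureTheory Polynomial ENNReal

/-- Two such points `x ≤ y` satisfy `(y / x) ^ m ≤ K ^ 2`, so Bernoulli's inequality gives `m (y / x
- 1) ≤ K ^ 2`. -/
theorem volume_pow_mul_mem_Ioo_le (K c : ℝ) {m : ℕ} (hK : 0 < K) (hm : 0 < m) :
    volume {a : ℝ | 0 < a ∧ a < K ∧ K⁻¹ < a ^ m * c ∧ a ^ m * c < K}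
      ≤ ENNReal.ofReal (K ^ 3 / m) := by
  have key : ∀ x y : ℝ, 0 < x → x ≤ y → x < K → K⁻¹ < x ^ m * c → y ^ m * c < K →
      y - x ≤ K ^ 3 / m := by
    intro x y hx hxy hxK h1 h2
    have hc : 0 < c := by
      have : 0 < x ^ m * c := (inv_pos.2 hK).trans h1
      exact (mul_pos_iff_of_pos_left (pow_pos hx m)).1 this
    have hxm := pow_pos hx m
    have h3 : y ^ m ≤ K ^ 2 * x ^ m := by
      have h4 : 1 < K * (x ^ m * c) := by
        rw [inv_lt_iff_one_lt_mul₀ hK] at h1; linarith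
      have h5 : y ^ m * c ≤ K ^ 2 * x ^ m * c := by nlinarith
      exact le_of_mul_le_mul_right h5 hc
    have h6 := one_add_mul_le_pow (a := y / x - 1)
      (by have : 0 ≤ y / x := div_nonneg (hx.le.trans hxy) hx.le
          linarith) m
    have h7 : (1 + (y / x - 1)) ^ m ≤ K ^ 2 := by
      rw [add_sub_cancel, div_pow, div_le_iff₀ hxm]; exact h3
    have h8 : (m : ℝ) * (y / x - 1) ≤ K ^ 2 := by linarith
    have h9 : (m : ℝ) * (y - x) ≤ K ^ 2 * x := by
      have := mul_le_mul_of_nonneg_right h8 hx.le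
      have e : (m : ℝ) * (y / x - 1) * x = m * (y - x) := by field_simp
      linarith
    rw [le_div_iff₀ (by positivity)]
    nlinarith [sq_nonneg K, mul_le_mul_of_nonneg_left hxK.le (sq_nonneg K)]
  refine (Real.volume_le_diam _).trans (Metric.ediam_le ?_)
  rintro x ⟨hx0, hxK, hx1, hx2⟩ y ⟨hy0, hyK, hy1, hy2⟩
  rw [edist_dist]
  refine ENNReal.ofReal_le_ofReal ?_
  rcases le_total x y with h | h
  · rw [dist_comm, Real.dist_eq, abs_of_nonneg (by linarith)]
    exact key x y hx0 h hxK hx1 hy2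
  · rw [Real.dist_eq, abs_of_nonneg (by linarith)]
    exact key y x hy0 h hyK hy1 hx2

/-- The pairs `(a, w)` in a bounded region for which `a ^ m * P w` has moderate size and the second
logarithmic derivative of `P` at `w` is of order at least `m ^ 2`. -/
def steepSet (K : ℝ) (m : ℕ) (P : ℂ[X]) : Set (ℝ × ℂ) :=
  {p | (0 < p.1 ∧ p.1 < K ∧ K⁻¹ < p.1 ^ m * ‖P.eval p.2‖ ∧ p.1 ^ m * ‖P.eval p.2‖ < K) ∧
    ‖p.2‖ < K ∧ (m : ℝ) ^ 2 * ‖P.eval p.2‖ ^ 2 < K * ‖(derivative P).eval p.2 ^ 2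
      - P.eval p.2 * (derivative (derivative P)).eval p.2‖}

theorem isOpen_steepSet (K : ℝ) (m : ℕ) (P : ℂ[X]) : IsOpen (steepSet K m P) := by
  have h : ∀ R : ℂ[X], Continuous fun p : ℝ × ℂ => R.eval p.2 := fun R =>
    R.continuous.comp continuous_snd
  have h0 := h P
  have h1 := h (derivative P)
  have h2 := h (derivative (derivative P))
  have hc : Continuous fun p : ℝ × ℂ => p.1 ^ m * ‖P.eval p.2‖ := by fun_prop
  refine ((isOpen_lt continuous_const continuous_fst).and
    ((isOpen_lt continuous_fst continuous_const).and ((isOpen_lt continuous_const hc).and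
    (isOpen_lt hc continuous_const)))).and ((isOpen_lt (by fun_prop) continuous_const).and
    (isOpen_lt (by fun_prop) (by fun_prop)))

theorem volume_steepSet_le {K : ℝ} (hK : 0 < K) : ∃ C : ℝ, 0 ≤ C ∧ ∀ (m : ℕ) (P : ℂ[X]), 0 < m →
    P.natDegree ≤ m →
      volume (steepSet K m P) ≤ ENNReal.ofReal (C * (1 / (m : ℝ) ^ (3 / 2 : ℝ))) := by
  obtain ⟨C, hC, hvol⟩ := volume_le_norm_sum_inv_sq K
  refine ⟨K ^ 3 * (C * K ^ (3 / 4 : ℝ)), by positivity, fun m P hm hP => ?_⟩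
  have hm' : (0 : ℝ) < m := by exact_mod_cast hm
  set B := {w : ℂ | ‖w‖ < K ∧
    (m : ℝ) ^ 2 / K ≤ ‖(P.roots.map fun z => ((w - z) ^ 2)⁻¹).sum‖} with hB
  -- Slices in `a` are empty unless `w ∈ B`. The measurable hull avoids proving `B` measurable.
  have hslice : ∀ w : ℂ, volume ((fun a : ℝ => (a, w)) ⁻¹' steepSet K m P)
      ≤ (toMeasurable volume B).indicator (fun _ => ENNReal.ofReal (K ^ 3 / m)) w := by
    intro w
    rcases Set.eq_empty_or_nonempty ((fun a : ℝ => (a, w)) ⁻¹' steepSet K m P) with h | ⟨a, ha⟩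
    · rw [h]; simp
    · have hw : w ∈ B := by
        obtain ⟨⟨ha0, -, ha1, -⟩, hwK, hw⟩ := ha
        refine ⟨hwK, ?_⟩
        dsimp only at ha0 ha1 hw hwK
        have hPw : P.eval w ≠ 0 := by
          intro h
          rw [h] at ha1
          have := inv_pos.2 hK
          simp only [norm_zero, mul_zero] at ha1
          linarith
        rw [eval_derivative_sq_sub P w hPw, norm_mul, norm_pow] at hw
        have hn : 0 < ‖P.eval w‖ ^ 2 := by positivity
        rw [div_le_iff₀ hK]
        refine le_of_mul_le_mul_right (hw.le.trans_eq ?_) hn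
        ring
      rw [Set.indicator_of_mem (subset_toMeasurable _ _ hw)]
      refine le_trans (measure_mono ?_) (volume_pow_mul_mem_Ioo_le K ‖P.eval w‖ hK hm)
      exact fun a ha => ha.1
  have hvB : volume B ≤ ENNReal.ofReal (C * m / ((m : ℝ) ^ 2 / K) ^ (3 / 4 : ℝ)) := by
    refine (hvol P.roots _ (by positivity)).trans (ENNReal.ofReal_le_ofReal ?_)
    gcongr
    exact P.card_roots'.trans hP
  calc volume (steepSet K m P)
      = ∫⁻ w, volume ((fun a : ℝ => (a, w)) ⁻¹' steepSet K m P) := by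
        rw [Measure.volume_eq_prod, Measure.prod_apply_symm (isOpen_steepSet K m P).measurableSet]
    _ ≤ ∫⁻ w, (toMeasurable volume B).indicator (fun _ => ENNReal.ofReal (K ^ 3 / m)) w :=
        lintegral_mono hslice
    _ = ENNReal.ofReal (K ^ 3 / m) * volume B := by
        rw [lintegral_indicator_const (measurableSet_toMeasurable _ _), measure_toMeasurable]
    _ ≤ ENNReal.ofReal (K ^ 3 / m) * ENNReal.ofReal (C * m / ((m : ℝ) ^ 2 / K) ^ (3 / 4 : ℝ)) := by
        gcongr
    _ = _ := by
        rw [← ENNReal.ofReal_mul (by positivity)]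
        congr 1
        have e : ((m : ℝ) ^ 2) ^ (3 / 4 : ℝ) = (m : ℝ) ^ (3 / 2 : ℝ) := by
          rw [← Real.rpow_natCast, ← Real.rpow_mul hm'.le]
          norm_num
        rw [Real.div_rpow (by positivity) hK.le, e]
        field_simp

theorem volume_frequently_mem_steepSet {K : ℝ} (hK : 0 < K) (Q : ℕ → ℂ[X])
    (hQ : ∀ n, (Q n).natDegree ≤ n) :
    volume {p | ∃ᶠ m in Filter.atTop, p ∈ steepSet K m (Q m)} = 0 := by
  obtain ⟨C, hC, hvol⟩ := volume_steepSet_le hK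
  have h : volume {p | ∃ᶠ m in Filter.atTop, p ∈ steepSet K (m + 1) (Q (m + 1))} = 0 := by
    refine measure_setOfPred_frequently_eq_zero (p := fun m p => p ∈ steepSet K (m + 1) (Q (m + 1))) ?_
    refine ne_top_of_le_ne_top ?_
      (ENNReal.tsum_le_tsum fun m => hvol (m + 1) (Q (m + 1)) m.succ_pos (hQ _))
    have hs : Summable fun m : ℕ => C * (1 / ((m + 1 : ℕ) : ℝ) ^ (3 / 2 : ℝ)) :=
      ((summable_nat_add_iff 1).2
        (Real.summable_one_div_nat_rpow.2 (by norm_num : (1 : ℝ) < 3 / 2))).mul_left C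
    exact hs.tsum_ofReal_ne_top
  refine measure_mono_null (fun p hp => ?_) h
  rw [Set.mem_ofPred_eq, Filter.frequently_atTop] at hp ⊢
  intro n
  obtain ⟨b, hb, hpb⟩ := hp (n + 1)
  obtain ⟨b, rfl⟩ : ∃ c, b = c + 1 := ⟨b - 1, by omega⟩
  exact ⟨b, by omega, hpb⟩

end Slices

/-! ### Appell polynomials of the orbit of `T`. -/

section AppellPolynomials

open Polynomial

/-- The Appell polynomials `∑ j ≤ n, (n choose j) c_{n - j} X ^ j` of a sequence `c`. -/
noncomputable def appell (c : ℕ → ℂ) (n : ℕ) : ℂ[X] :=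
  ∑ j ∈ Finset.range (n + 1), monomial j (c (n - j) * n.choose j)

theorem coeff_appell (c : ℕ → ℂ) (n j : ℕ) : (appell c n).coeff j = c (n - j) * n.choose j := by
  simp only [appell, finsetSum_coeff, coeff_monomial, Finset.sum_ite_eq', Finset.mem_range]
  split_ifs with h
  · rfl
  · rw [Nat.choose_eq_zero_of_lt (by omega)]; simp

theorem natDegree_appell_le (c : ℕ → ℂ) (n : ℕ) : (appell c n).natDegree ≤ n :=
  natDegree_le_iff_coeff_eq_zero.2 fun j hj => by
    rw [coeff_appell, Nat.choose_eq_zero_of_lt hj]; simp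

theorem derivative_appell (c : ℕ → ℂ) (n : ℕ) :
    derivative (appell c (n + 1)) = C ((n : ℂ) + 1) * appell c n := by
  ext j
  rw [coeff_derivative, coeff_C_mul, coeff_appell, coeff_appell, Nat.add_sub_add_right]
  have h : ((n : ℂ) + 1) * n.choose j = (n + 1).choose (j + 1) * (j + 1) := by
    exact_mod_cast Nat.add_one_mul_choose_eq n j
  linear_combination -c (n - j) * h

theorem eval_appell {X : Type*} [AddCommGroup X] [Module ℂ X] [TopologicalSpace X]
    [IsTopologicalAddGroup X] [ContinuousSMul ℂ X] (f : X →L[ℂ] ℂ) (T : X →L[ℂ] X) (x : X)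
    (n : ℕ) (w : ℂ) :
    (appell (fun k => f ((T ^ k) x)) n).eval w
      = f (((T + w • ContinuousLinearMap.id ℂ X) ^ n) x) := by
  have hcomm : Commute (w • ContinuousLinearMap.id ℂ X) T := by
    ext y; simp
  have hpow : ∀ k, (w • ContinuousLinearMap.id ℂ X) ^ k = w ^ k • ContinuousLinearMap.id ℂ X := by
    intro k
    change (w • (1 : X →L[ℂ] X)) ^ k = w ^ k • (1 : X →L[ℂ] X)
    rw [_root_.smul_pow, one_pow]
  rw [add_comm T, hcomm.add_pow, appell, eval_finsetSum, _root_.sum_apply, map_sum]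
  refine Finset.sum_congr rfl fun j _ => ?_
  rw [eval_monomial, hpow, (Nat.cast_commute (n.choose j) _).eq.symm, ← nsmul_eq_mul]
  simp [mul_comm]

end AppellPolynomials

/-! ### Consequences of a dense orbit. -/

section Orbits

open Filter Topology Polynomial

variable {X : Type*} [AddCommGroup X] [Module ℂ X] [TopologicalSpace X]
  [IsTopologicalAddGroup X]

/-- The adjoint of a hypercyclic operator has no eigenvectors. -/
theorem exists_functional_comp_ne_mul {S : X →L[ℂ] X} {x : X} (hx : x ∈ hypercyclicVectors S)
    {f : X →L[ℂ] ℂ} (hf : f ≠ 0) (l : ℂ) : ∃ y, f (S y) ≠ l * f y := by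
  by_contra! h
  have hsurj : Function.Surjective f :=
    LinearMap.surjective (f := f.toLinearMap) fun h => hf (ContinuousLinearMap.coe_injective h)
  have hd : DenseRange fun n : ℕ => f ((S ^ n) x) :=
    hsurj.denseRange.comp (show DenseRange fun n : ℕ => (S ^ n) x from hx) f.continuous
  have hpow : ∀ n : ℕ, f ((S ^ n) x) = l ^ n * f x := by
    intro n
    induction n with
    | zero => simp
    | succ n ih => rw [pow_succ', mul_apply_eq_comp, h, ih]; ring
  -- The values `l ^ n * f x` are dense in `ℂ`, yet they stay in a disc if `‖l‖ ≤ 1` and outside one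
  -- if `‖l‖ ≥ 1`, unless `f x = 0`.
  have hclosed : ∀ s : Set ℂ, IsClosed s → (∀ n : ℕ, l ^ n * f x ∈ s) → ∀ z, z ∈ s := by
    intro s hs hmem z
    refine closure_minimal ?_ hs (hd z)
    rintro _ ⟨n, rfl⟩
    simpa only [hpow] using hmem n
  have hbdd : ¬ ∀ n : ℕ, ‖l ^ n * f x‖ ≤ ‖f x‖ := by
    intro hb
    have := hclosed (Metric.closedBall 0 ‖f x‖) Metric.isClosed_closedBall
      (by simpa using hb) ((‖f x‖ + 1 : ℝ) : ℂ)
    rw [mem_closedBall_zero_iff, Complex.norm_real, Real.norm_of_nonneg (by positivity)] at this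
    linarith
  rcases le_total ‖l‖ 1 with hl | hl
  · refine hbdd fun n => ?_
    rw [norm_mul, norm_pow]
    exact mul_le_of_le_one_left (norm_nonneg _) (pow_le_one₀ (norm_nonneg _) hl)
  · have h0 := hclosed {z | ‖f x‖ ≤ ‖z‖} (isClosed_le continuous_const continuous_norm)
      (fun n => by
        rw [Set.mem_ofPred_eq, norm_mul, norm_pow]
        exact le_mul_of_one_le_left (norm_nonneg _) (one_le_pow₀ hl)) 0
    have hfx : f x = 0 := by simpa using h0
    exact hbdd fun n => by simp [hfx]

variable [ContinuousSMul ℂ X] [T2Space X]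

theorem frequently_mem_of_dense_orbit [Nontrivial X] {S : X →L[ℂ] X} {x : X}
    (hx : x ∈ hypercyclicVectors S) {V : Set X} (hV : IsOpen V) (hne : V.Nonempty) :
    ∃ᶠ n in atTop, (S ^ n) x ∈ V := by
  have : ∀ y : X, NeBot (𝓝[≠] y) := fun y => Module.punctured_nhds_neBot ℂ X y
  rw [frequently_atTop]
  intro N
  -- Without isolated points, density survives the removal of the first `N` terms.
  have hd := Dense.sdiff_finite (show Dense (Set.range fun n : ℕ => (S ^ n) x) from hx)
    ((Set.finite_Iio N).image fun n => (S ^ n) x)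
  obtain ⟨y, hyV, ⟨n, rfl⟩, hn⟩ := hd.inter_open_nonempty V hV hne
  refine ⟨n, ?_, hyV⟩
  by_contra h
  exact hn ⟨n, by simpa using h, rfl⟩

theorem exists_functional_orbit_not_geometric {S : X →L[ℂ] X} {x : X}
    (hx : x ∈ hypercyclicVectors S) {f : X →L[ℂ] ℂ} (hf : f ≠ 0) :
    ∃ u, f (S (S u)) ≠ 0 ∧ f (S u) ^ 2 - f u * f (S (S u)) ≠ 0 := by
  obtain ⟨v₀, hv₀⟩ : ∃ v, f v ≠ 0 := by
    by_contra! h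
    exact hf (ContinuousLinearMap.ext h)
  have : Nontrivial X := ⟨v₀, 0, fun h => hv₀ (by simp [h])⟩
  obtain ⟨v, hv⟩ : ∃ v, f (S (S v)) ≠ 0 := by
    obtain ⟨n, hn, hfn⟩ := frequently_atTop.1 (frequently_mem_of_dense_orbit hx
      (V := {y | f y ≠ 0}) (isOpen_ne_fun f.continuous continuous_const) ⟨v₀, hv₀⟩) 2
    obtain ⟨k, rfl⟩ := Nat.exists_eq_add_of_le' hn
    refine ⟨(S ^ k) x, ?_⟩
    simpa [pow_succ'] using hfn
  obtain ⟨u, hu0, hu1⟩ : ∃ u, f u = 0 ∧ f (S u) ≠ 0 := by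
    by_contra! h
    -- If `S` preserved the kernel of `f`, then `f ∘ S` would be a multiple of `f`.
    obtain ⟨y, hy⟩ := exists_functional_comp_ne_mul hx hf (f (S v₀) / f v₀)
    refine hy ?_
    have := h (y - (f y / f v₀) • v₀) (by simp [hv₀])
    rw [map_sub, map_sub, map_smul, map_smul, sub_eq_zero, smul_eq_mul] at this
    rw [this]; ring
  by_cases hu2 : f (S (S u)) = 0
  -- A small move along `v` makes `f (S (S u))` nonzero and keeps the other quantity nonzero.
  · have hc : Continuous fun t : ℂ => f (S (u + t • v)) ^ 2
        - f (u + t • v) * f (S (S (u + t • v))) := by fun_prop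
    have h1 : ∀ᶠ t in 𝓝[≠] (0 : ℂ), f (S (u + t • v)) ^ 2
        - f (u + t • v) * f (S (S (u + t • v))) ≠ 0 :=
      (hc.continuousAt.eventually_ne (by simpa [hu2] using hu1)).filter_mono nhdsWithin_le_nhds
    obtain ⟨t, ht, ht0⟩ := (h1.and self_mem_nhdsWithin).exists
    refine ⟨u + t • v, ?_, ht⟩
    simp only [map_add, map_smul, hu2, zero_add, smul_eq_mul]
    exact mul_ne_zero ht0 hv
  · exact ⟨u, hu2, by simpa [hu0] using hu1⟩

/-- Three consecutive orbit terms encode `q_m` and its first two derivatives at `w`, so an orbit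
point near a suitable `u` gives the steepness. -/
theorem exists_frequently_mem_steepSet {T : X →L[ℂ] X} {x : X} {f : X →L[ℂ] ℂ} (hf : f ≠ 0)
    {a : ℝ} (ha : 0 < a) (w : ℂ)
    (hx : x ∈ hypercyclicVectors ((a : ℂ) • T + ((a : ℂ) * w) • ContinuousLinearMap.id ℂ X)) :
    ∃ K : ℕ, 0 < K ∧ ∃ᶠ m in atTop, (a, w) ∈ steepSet K m (appell (fun k => f ((T ^ k) x)) m) := by
  set S := (a : ℂ) • T + ((a : ℂ) * w) • ContinuousLinearMap.id ℂ X with hS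
  set q : ℕ → ℂ[X] := appell fun k => f ((T ^ k) x)
  have hq : ∀ k, f ((S ^ k) x) = (a : ℂ) ^ k * (q k).eval w := by
    intro k
    have e : S = (a : ℂ) • (T + w • ContinuousLinearMap.id ℂ X) := by
      rw [hS, smul_add, mul_smul]
    rw [eval_appell, e, _root_.smul_pow, _root_.smul_apply, map_smul, smul_eq_mul]
  obtain ⟨u, hu2, hu⟩ := exists_functional_orbit_not_geometric hx hf
  have : Nontrivial X := ⟨u, 0, fun h => hu2 (by simp [h])⟩
  have hN : 0 < ‖f (S (S u))‖ := norm_pos_iff.2 hu2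
  have hF : 0 < a ^ 2 * ‖f (S u) ^ 2 - f u * f (S (S u))‖ :=
    mul_pos (by positivity) (norm_pos_iff.2 hu)
  have hgt : ∀ r : ℝ, ∀ᶠ K : ℕ in atTop, r < K :=
    tendsto_natCast_atTop_atTop.eventually_gt_atTop
  obtain ⟨K, hK0, hKa, hKw, hK1, hK2, hK3⟩ := ((hgt 0).and ((hgt a).and ((hgt ‖w‖).and
    ((hgt ‖f (S (S u))‖⁻¹).and ((hgt ‖f (S (S u))‖).and
    (hgt (‖f (S (S u))‖ ^ 2 / (a ^ 2 * ‖f (S u) ^ 2 - f u * f (S (S u))‖)))))))).exists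
  rw [div_lt_iff₀ hF] at hK3
  refine ⟨K, by exact_mod_cast hK0, ?_⟩
  -- The second coordinate stands for `1/m`, `m = n + 2`, since `q_m'' = m ^ 2 (1 - 1/m) q_{m-2}`.
  -- The factor `a ^ 2` balances the powers `a ^ (2m)` and `a ^ (2m - 2)`.
  set W : Set (X × ℂ) := {p | ((K : ℝ)⁻¹ < ‖f (S (S p.1))‖ ∧ ‖f (S (S p.1))‖ < K) ∧
    ‖f (S (S p.1))‖ ^ 2
      < K * (a ^ 2 * ‖f (S p.1) ^ 2 - (1 - p.2) * (f p.1 * f (S (S p.1)))‖)} with hW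
  have hWo : IsOpen W :=
    ((isOpen_lt continuous_const (by fun_prop)).and (isOpen_lt (by fun_prop) continuous_const)).and
      (isOpen_lt (by fun_prop) (by fun_prop))
  have hWu : (u, (0 : ℂ)) ∈ W :=
    ⟨⟨inv_lt_of_inv_lt₀ hN hK1, hK2⟩, by simpa using hK3⟩
  obtain ⟨V, hV, V', hV', hVW⟩ := mem_nhds_prod_iff.1 (hWo.mem_nhds hWu)
  obtain ⟨V₀, hV₀V, hV₀, huV₀⟩ := mem_nhds_iff.1 hV
  have hfreq := frequently_mem_of_dense_orbit hx hV₀ ⟨u, huV₀⟩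
  have hlim : Tendsto (fun n : ℕ => ((((n + 2 : ℕ) : ℝ)⁻¹ : ℝ) : ℂ)) atTop (𝓝 0) := by
    have := (tendsto_inv_atTop_nhds_zero_nat (𝕜 := ℝ)).comp (tendsto_add_atTop_nat 2)
    have h0 := (Complex.continuous_ofReal.tendsto 0).comp this
    rwa [Complex.ofReal_zero] at h0
  have hfreq2 : ∃ᶠ n in atTop, (a, w) ∈ steepSet K (n + 2) (q (n + 2)) := by
    refine (hfreq.and_eventually (hlim.eventually hV')).mono ?_
    rintro n ⟨hn, hn'⟩
    obtain ⟨⟨h1, h2⟩, h3⟩ := hVW (Set.mk_mem_prod (hV₀V hn) hn')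
    have e1 : f (S ((S ^ n) x)) = (a : ℂ) ^ (n + 1) * (q (n + 1)).eval w := by
      rw [← hq, pow_succ']; rfl
    have e2 : f (S (S ((S ^ n) x))) = (a : ℂ) ^ (n + 2) * (q (n + 2)).eval w := by
      rw [← hq, pow_succ', pow_succ']; rfl
    dsimp only at h1 h2 h3
    rw [e1, e2, hq n] at h3
    rw [e2, norm_mul, norm_pow, Complex.norm_real, Real.norm_of_nonneg ha.le] at h1 h2
    refine ⟨⟨ha, hKa, h1, h2⟩, hKw, ?_⟩
    have hd1 : derivative (q (n + 2)) = C (((n + 1 : ℕ) : ℂ) + 1) * q (n + 1) :=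
      derivative_appell _ _
    have hd2 : derivative (q (n + 1)) = C ((n : ℂ) + 1) * q n := derivative_appell _ _
    have hm0 : ((n : ℂ) + 2) ≠ 0 := by exact_mod_cast (by omega : n + 2 ≠ 0)
    set Q0 := (q n).eval w
    set Q1 := (q (n + 1)).eval w
    set Q2 := (q (n + 2)).eval w
    set G : ℂ := Q1 ^ 2 - (1 - ((n : ℂ) + 2)⁻¹) * (Q0 * Q2) with hG
    have e3 : (derivative (q (n + 2))).eval w ^ 2
        - Q2 * (derivative (derivative (q (n + 2)))).eval w = ((n : ℂ) + 2) ^ 2 * G := by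
      simp only [hd1, hd2, derivative_C_mul, eval_mul, eval_C, hG]
      push_cast
      field_simp
      ring
    have e4 : ((a : ℂ) ^ (n + 1) * Q1) ^ 2 - (1 - ((((n + 2 : ℕ) : ℝ)⁻¹ : ℝ) : ℂ))
        * ((a : ℂ) ^ n * Q0 * ((a : ℂ) ^ (n + 2) * Q2)) = (a : ℂ) ^ (2 * n + 2) * G := by
      rw [hG]; push_cast; ring
    rw [e3, norm_mul, norm_pow]
    rw [e4, norm_mul, norm_mul, norm_pow, norm_pow, Complex.norm_real,
      Real.norm_of_nonneg ha.le] at h3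
    have e5 : ‖(n : ℂ) + 2‖ = ((n + 2 : ℕ) : ℝ) := by
      rw [← Complex.norm_natCast]; push_cast; rfl
    rw [e5]
    have hap : 0 < a ^ (2 * n + 4) := pow_pos ha _
    have h4 : ‖Q2‖ ^ 2 < K * ‖G‖ := by
      refine lt_of_mul_lt_mul_left (lt_of_eq_of_lt ?_ (h3.trans_eq ?_)) hap.le <;> ring
    have hm : (0 : ℝ) < ((n + 2 : ℕ) : ℝ) ^ 2 := by positivity
    calc _ < ((n + 2 : ℕ) : ℝ) ^ 2 * (K * ‖G‖) := mul_lt_mul_of_pos_left h4 hm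
      _ = _ := by ring
  rw [frequently_atTop] at hfreq2 ⊢
  intro N
  obtain ⟨n, hn, hmem⟩ := hfreq2 N
  exact ⟨n + 2, by omega, hmem⟩

end Orbits

theorem theorem2 {X : Type*} [AddCommGroup X] [Module ℂ X] [TopologicalSpace X]
    [IsTopologicalAddGroup X] [ContinuousSMul ℂ X] [T2Space X]
    (hX : ∃ f : X →L[ℂ] ℂ, f ≠ 0) (T : X →L[ℂ] X)
    (Λ : Set (ℝ × ℂ)) (hΛ : Λ ⊆ Set.Ici (0 : ℝ) ×ˢ (Set.univ : Set ℂ))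
    (hcommon : (commonHypercyclicVectors fun p : Λ =>
      ((p : ℝ × ℂ).1 : ℂ) • T + (p : ℝ × ℂ).2 • ContinuousLinearMap.id ℂ X).Nonempty) :
    (MeasureTheory.volume : MeasureTheory.Measure (ℝ × ℂ)) Λ = 0 := by
  obtain ⟨f, hf⟩ := hX
  obtain ⟨x, hx⟩ := hcommon
  set N : Set (ℝ × ℂ) := ⋃ K : ℕ, ⋃ _ : 0 < K,
    {p | ∃ᶠ m in Filter.atTop, p ∈ steepSet K m (appell (fun k => f ((T ^ k) x)) m)} with hN
  have hN0 : MeasureTheory.volume N = 0 := by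
    refine MeasureTheory.measure_iUnion_null fun K => MeasureTheory.measure_iUnion_null fun hK => ?_
    exact volume_frequently_mem_steepSet (by exact_mod_cast hK) _ (natDegree_appell_le _)
  have hHaar : (MeasureTheory.volume : MeasureTheory.Measure (ℝ × ℂ)).IsAddHaarMeasure := by
    rw [MeasureTheory.Measure.volume_eq_prod]
    infer_instance
  -- Back from `(a, w)` to `(a, b)`: a differentiable map preserves null sets.
  have himage : MeasureTheory.volume ((fun p : ℝ × ℂ => (p.1, (p.1 : ℂ) * p.2)) '' N) = 0 := by
    refine MeasureTheory.addHaar_image_eq_zero_of_differentiableOn_of_addHaar_eq_zero _ ?_ hN0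
    refine Differentiable.differentiableOn (differentiable_fst.prodMk ?_)
    exact (Complex.ofRealCLM.differentiable.comp differentiable_fst).mul differentiable_snd
  have hplane : MeasureTheory.volume (({0} : Set ℝ) ×ˢ (Set.univ : Set ℂ)) = 0 := by
    rw [MeasureTheory.Measure.volume_eq_prod, MeasureTheory.Measure.prod_prod]
    simp
  refine MeasureTheory.measure_mono_null ?_ (MeasureTheory.measure_union_null himage hplane)
  rintro ⟨a, b⟩ hab
  rcases (show (0 : ℝ) ≤ a from (hΛ hab).1).eq_or_lt with rfl | ha
  · exact Or.inr ⟨rfl, trivial⟩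
  · have hac : (a : ℂ) ≠ 0 := by exact_mod_cast ha.ne'
    have hxab := Set.mem_iInter.1 hx ⟨(a, b), hab⟩
    have hb : (a : ℂ) * (b / a) = b := by field_simp
    obtain ⟨K, hK, hfreq⟩ := exists_frequently_mem_steepSet (T := T) (x := x) hf ha (b / a)
      (by rw [hb]; exact hxab)
    refine Or.inl ⟨(a, b / a), ?_, by simp only [hb]⟩
    exact Set.mem_iUnion.2 ⟨K, Set.mem_iUnion.2 ⟨hK, hfreq⟩⟩
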